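/- Let $p\ge 1$ be real and let $c:\mathbb R\times\mathbb R\to[0,\infty)$ be a metric on $\mathbb R$ that is lower semicontinuous for the usual topology of $\mathbb R^2$ (for example $c(x,y)=|x-y|$). For $i=1,2$ let $\Omega_i$ be a non-empty separable metrizable space with a finite Borel measure that charges every non-empty open set (for example a sphere with its surface measure), let $\mathcal U(\Omega_i)$ be this measure normalised to total mass one, and let $g_i:\mathbb R^{d_i}\times\Omega_i\to\mathbb R$ be a defining function, measurable in its first and continuous in its second argument. Let $\mathcal U(\mathbb S)$ be the uniform distribution on the unit circle $\mathbb S\subset\mathbb R^2$ and let $\mathcal U=\mathcal U(\Omega_1)\otimes\mathcal U(\Omega_2)\otimes\mathcal U(\mathbb S)$ be the uniform distribution on $\Omega_1\times\Omega_2\times\mathbb S$. The generalized Radon transform with defining function $g:\mathbb R^d\times\Omega\to\mathbb R$ sends a finite signed Borel measure $\sigma$ on $\mathbb R^d$ to the family $(g(\cdot,\theta)_\sharp\sigma)_{\theta\in\Omega}$ of its images on $\mathbb R$, formally $t\mapsto\int\delta(t-g(x,\theta))\,d\sigma(x)$; the transform of $f\in L^1(\mathbb R^d)$ is that of $f\,dx$.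 For probability measures $\alpha,\beta$ on $\mathbb R$ put $$W_p^p(\alpha,\beta;c)=\inf_{\pi\in\Pi(\alpha,\beta)}\int c(x,y)^p\,d\pi(x,y)\in[0,\infty],$$ where $\Pi(\alpha,\beta)$ is the set of couplings. For $\theta_i\in\Omega_i$, $\psi=(\psi_1,\psi_2)\in\mathbb S$ put $h_{\theta_1,\theta_2,\psi}(x_1,x_2)=\psi_1g_1(x_1,\theta_1)+\psi_2g_2(x_2,\theta_2)$, and for $\mu,\nu\in\mathcal P(\mathbb R^{d_1}\times\mathbb R^{d_2})$, the Borel probability measures, put $$\mathrm{H2SW}_p(\mu,\nu;c,g_1,g_2)=\Big(\int W_p^p\big((h_{\theta_1,\theta_2,\psi})_\sharp\mu,(h_{\theta_1,\theta_2,\psi})_\sharp\nu;c\big)\,d\mathcal U(\theta_1,\theta_2,\psi)\Big)^{1/p}\in[0,\infty].$$ (a) If the generalized Radon transforms with defining functions $g_1$ and $g_2$ are injective on finite signed measures, then $\mathrm{H2SW}_p(\cdot,\cdot;c,g_1,g_2)$ is a metric on $\mathcal P(\mathbb R^{d_1}\times\mathbb R^{d_2})$, possibly with the value $\infty$: it is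 non-negative, symmetric, satisfies the triangle inequality, and $\mathrm{H2SW}_p(\mu,\nu;c,g_1,g_2)=0$ if and only if $\mu=\nu$. (b) If they are only assumed injective on $L^1(\mathbb R^{d_1})$ and $L^1(\mathbb R^{d_2})$ respectively, the same holds on the set of $\mu\in\mathcal P(\mathbb R^{d_1}\times\mathbb R^{d_2})$ that have a density with respect to Lebesgue measure. (c) $\mathrm{H2SW}_p(\mu,\nu;c,g_1,g_2)$ is finite whenever both $\rho=\mu$ and $\rho=\nu$ satisfy $\iint c\big(0,h_{\theta_1,\theta_2,\psi}(x)\big)^p\,d\rho(x)\,d\mathcal U(\theta_1,\theta_2,\psi)<\infty$. -/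

import Mathlib

open MeasureTheory Set
open scoped ENNReal NNReal

noncomputable section

namespace H2SW

/-- The Euclidean space `ℝ^d`. -/
abbrev E (d : ℕ) : Type := EuclideanSpace ℝ (Fin d)

/-- The unit circle `𝕊 ⊆ ℝ²`. -/
abbrev Circ : Type := Metric.sphere (0 : EuclideanSpace ℝ (Fin 2)) 1

/-- The uniform distribution with respect to a finite reference measure `m`
(for a sphere, `m` is the surface measure): `m` normalised to total mass one. -/
def uniformLaw {Ω : Type*} [MeasurableSpace Ω] (m : Measure Ω) : Measure Ω :=
  (m univ)⁻¹ • m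

/-- The uniform distribution on the unit circle. -/
def uniformCirc : Measure Circ :=
  uniformLaw (volume : Measure (EuclideanSpace ℝ (Fin 2))).toSphere

/-- `c` satisfies the axioms of a metric (non-negativity is built into the type). -/
structure IsMetric {X : Type*} (c : X → X → ℝ≥0) : Prop where
  eq_zero_iff : ∀ x y, c x y = 0 ↔ x = y
  symm : ∀ x y, c x y = c y x
  triangle : ∀ x y z, c x z ≤ c x y + c y z

/-- The couplings of two measures on `ℝ`. -/
def couplings (μ ν : Measure ℝ) : Set (Measure (ℝ × ℝ)) :=
  {π | π.map Prod.fst = μ ∧ π.map Prod.snd = ν}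

/-- The `p`-th power `W_p^p(μ, ν; c)` of the Wasserstein distance with ground metric `c`. -/
def wassersteinPow (p : ℝ) (c : ℝ → ℝ → ℝ≥0) (μ ν : Measure ℝ) : ℝ≥0∞ :=
  ⨅ π ∈ couplings μ ν, ∫⁻ z, (c z.1 z.2 : ℝ≥0∞) ^ p ∂π

/-- The generalized Radon transform with defining function `g`, on finite signed measures: the
measure `∫ δ(t - g(x, θ)) dσ(x)` in the variable `t`, that is, the image of `σ` under `g(·, θ)`. -/
def GRT {d : ℕ} {Ω : Type*} (g : E d → Ω → ℝ) (σ : SignedMeasure (E d)) (θ : Ω) :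
    SignedMeasure ℝ :=
  σ.map (fun x => g x θ)

/-- The generalized Radon transform is injective on finite signed measures. -/
def GRTInjective {d : ℕ} {Ω : Type*} (g : E d → Ω → ℝ) : Prop :=
  Function.Injective (GRT g)

/-- The generalized Radon transform is injective on `L¹(ℝ^d)`; the transform of a function `f` is
that of the signed measure `f dx`. -/
def GRTInjectiveL1 {d : ℕ} {Ω : Type*} (g : E d → Ω → ℝ) : Prop :=
  ∀ f₁ f₂ : E d → ℝ, Integrable f₁ volume → Integrable f₂ volume →
    (∀ θ, GRT g ((volume : Measure (E d)).withDensityᵥ f₁) θ =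
      GRT g ((volume : Measure (E d)).withDensityᵥ f₂) θ) →
    f₁ =ᵐ[volume] f₂

section

variable {d₁ d₂ : ℕ} {Ω₁ Ω₂ : Type*} [MeasurableSpace Ω₁] [MeasurableSpace Ω₂]

/-- The slicing map `(x₁, x₂) ↦ ψ₁ g₁(x₁, θ₁) + ψ₂ g₂(x₂, θ₂)` with parameter `(θ₁, θ₂, ψ)`. -/
def slice (g₁ : E d₁ → Ω₁ → ℝ) (g₂ : E d₂ → Ω₂ → ℝ) (ω : Ω₁ × Ω₂ × Circ)
    (x : E d₁ × E d₂) : ℝ :=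
  ω.2.2.1 0 * g₁ x.1 ω.1 + ω.2.2.1 1 * g₂ x.2 ω.2.1

/-- The one-dimensional image of `μ` under the hierarchical hybrid Radon transform. -/
def HHR (g₁ : E d₁ → Ω₁ → ℝ) (g₂ : E d₂ → Ω₂ → ℝ) (ω : Ω₁ × Ω₂ × Circ)
    (μ : Measure (E d₁ × E d₂)) : Measure ℝ :=
  μ.map (slice g₁ g₂ ω)

/-- The uniform distribution on `Ω₁ × Ω₂ × 𝕊`, for reference measures `m₁`, `m₂`. -/
def slicingLaw (m₁ : Measure Ω₁) (m₂ : Measure Ω₂) : Measure (Ω₁ × Ω₂ × Circ) :=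
  (uniformLaw m₁).prod ((uniformLaw m₂).prod uniformCirc)

/-- The hierarchical hybrid sliced Wasserstein distance of order `p`, with values in `[0, ∞]`. -/
def h2sw (p : ℝ) (c : ℝ → ℝ → ℝ≥0) (m₁ : Measure Ω₁) (m₂ : Measure Ω₂)
    (g₁ : E d₁ → Ω₁ → ℝ) (g₂ : E d₂ → Ω₂ → ℝ)
    (μ ν : ProbabilityMeasure (E d₁ × E d₂)) : ℝ≥0∞ :=
  (∫⁻ ω, wassersteinPow p c (HHR g₁ g₂ ω μ) (HHR g₁ g₂ ω ν) ∂(slicingLaw m₁ m₂)) ^ (1 / p)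

/-- The sliced `p`-th moment of `μ` with respect to `c` is finite. -/
def HasFiniteMoment (p : ℝ) (c : ℝ → ℝ → ℝ≥0) (m₁ : Measure Ω₁) (m₂ : Measure Ω₂)
    (g₁ : E d₁ → Ω₁ → ℝ) (g₂ : E d₂ → Ω₂ → ℝ)
    (μ : ProbabilityMeasure (E d₁ × E d₂)) : Prop :=
  ∫⁻ ω, ∫⁻ x, (c 0 (slice g₁ g₂ ω x) : ℝ≥0∞) ^ p ∂(μ : Measure (E d₁ × E d₂))
    ∂(slicingLaw m₁ m₂) < ∞

end

/-- `D` satisfies the axioms of a metric on `S`, the value `∞` being allowed. -/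
structure IsExtendedMetricOn {X : Type*} (S : Set X) (D : X → X → ℝ≥0∞) : Prop where
  nonneg : ∀ x ∈ S, ∀ y ∈ S, 0 ≤ D x y
  symm : ∀ x ∈ S, ∀ y ∈ S, D x y = D y x
  triangle : ∀ x ∈ S, ∀ y ∈ S, ∀ z ∈ S, D x z ≤ D x y + D y z
  eq_zero_iff : ∀ x ∈ S, ∀ y ∈ S, D x y = 0 ↔ x = y

end H2SW

end

/-! For each parameter `ω`, the distance of the slices is an extended metric on probability laws on
ℝ, and Minkowski's inequality in `L^p` of the slicing law carries the triangle inequality over to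
`h2sw`. Minkowski needs measurability in `ω`: by Prokhorov's theorem the transport cost is jointly
lower semicontinuous (`isClosed_wassersteinPow_le`), and the slices depend weakly continuously on
`ω` (`continuous_sliceLaw`).

If `h2sw` vanishes, the slices agree for almost every `ω`, hence for every `ω`, since the slicing
law charges every non-empty open set. Varying `ψ`, Cramér–Wold (`map_prodMk_eq_of_forall_circ`)
identifies the joint laws of `(g₁(x₁, θ₁), g₂(x₂, θ₂))`. Injectivity of the two transforms is then
applied to one variable at a time, the other being confined to a fixed set (`eq_of_map_prod_eq`).
`Determines` lets one argument serve both injectivity hypotheses. Finiteness comes from the product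
coupling. -/

namespace H2SW

open Filter Topology ProbabilityTheory

/-! ### Lower semicontinuity of integrals under weak convergence -/

section Semicontinuity

/-- Layer-cake formula, the portmanteau inequality on the open superlevel sets, then Fatou in the
level `t`. -/
theorem lintegral_le_liminf_lintegral_of_tendsto {X : Type*} [MeasurableSpace X]
    [TopologicalSpace X] [OpensMeasurableSpace X] [HasOuterApproxClosed X]
    {π : ProbabilityMeasure X} {πs : ℕ → ProbabilityMeasure X} {f : X → ℝ}
    (hf : LowerSemicontinuous f) (hf_nonneg : 0 ≤ f) (h : Tendsto πs atTop (𝓝 π)) :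
    ∫⁻ x, ENNReal.ofReal (f x) ∂(π : Measure X) ≤
      atTop.liminf (fun n => ∫⁻ x, ENNReal.ofReal (f x) ∂(πs n : Measure X)) := by
  simp_rw [lintegral_eq_lintegral_meas_lt _ (Eventually.of_forall hf_nonneg)
    hf.measurable.aemeasurable]
  refine (lintegral_mono fun t => ?_).trans (lintegral_liminf_le fun n =>
    Antitone.measurable fun s t hst => measure_mono fun x hx => lt_of_le_of_lt hst hx)
  exact ProbabilityMeasure.le_liminf_measure_open_of_tendsto h (hf.isOpen_preimage t)

end Semicontinuity

/-! ### Optimal transport on ℝ with a lower semicontinuous ground metric -/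

section Wasserstein

variable {p : ℝ} {c : ℝ → ℝ → ℝ≥0}

theorem measurable_cost (hc : LowerSemicontinuous (fun z : ℝ × ℝ => c z.1 z.2)) :
    Measurable (fun z : ℝ × ℝ => (c z.1 z.2 : ℝ≥0∞)) :=
  hc.measurable.coe_nnreal_ennreal

theorem isProbabilityMeasure_of_mem_couplings {μ ν : Measure ℝ} [IsProbabilityMeasure μ]
    {π : Measure (ℝ × ℝ)} (hπ : π ∈ couplings μ ν) : IsProbabilityMeasure π := by
  constructor
  have h := congrArg (fun m => m univ) hπ.1
  simpa [Measure.map_apply measurable_fst MeasurableSet.univ] using h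

theorem wassersteinPow_le {μ ν : Measure ℝ} {π : Measure (ℝ × ℝ)} (hπ : π ∈ couplings μ ν) :
    wassersteinPow p c μ ν ≤ ∫⁻ z, (c z.1 z.2 : ℝ≥0∞) ^ p ∂π :=
  iInf₂_le π hπ

theorem prod_mem_couplings (μ ν : Measure ℝ) [IsProbabilityMeasure μ] [IsProbabilityMeasure ν] :
    μ.prod ν ∈ couplings μ ν := by
  constructor <;> simp

theorem lintegral_cost_le_liminf (hp : 0 ≤ p)
    (hc : LowerSemicontinuous (fun z : ℝ × ℝ => c z.1 z.2))
    {π : ProbabilityMeasure (ℝ × ℝ)} {πs : ℕ → ProbabilityMeasure (ℝ × ℝ)}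
    (h : Tendsto πs atTop (𝓝 π)) :
    ∫⁻ z, (c z.1 z.2 : ℝ≥0∞) ^ p ∂(π : Measure (ℝ × ℝ)) ≤
      atTop.liminf (fun n => ∫⁻ z, (c z.1 z.2 : ℝ≥0∞) ^ p ∂(πs n : Measure (ℝ × ℝ))) := by
  have hpow : ∀ x : ℝ≥0, (x : ℝ≥0∞) ^ p = ENNReal.ofReal ((x : ℝ) ^ p) := fun x => by
    rw [← ENNReal.ofReal_rpow_of_nonneg x.coe_nonneg hp, ENNReal.ofReal_coe_nnreal]
  simp_rw [hpow]
  refine lintegral_le_liminf_lintegral_of_tendsto (f := fun z : ℝ × ℝ => ((c z.1 z.2 : ℝ≥0) : ℝ) ^ p)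
    ?_ (fun z => by positivity) h
  exact Continuous.comp_lowerSemicontinuous (g := fun x : ℝ≥0 => (x : ℝ) ^ p)
    (NNReal.continuous_coe.rpow_const fun _ => Or.inr hp) hc
    (fun x y hxy => Real.rpow_le_rpow x.2 (by exact_mod_cast hxy) hp)

/-- A convergent sequence together with its limit is compact, and on ℝ compact sets of laws are
tight. -/
theorem isTightMeasureSet_range_of_tendsto {αs : ℕ → ProbabilityMeasure ℝ}
    {α : ProbabilityMeasure ℝ} (h : Tendsto αs atTop (𝓝 α)) :
    IsTightMeasureSet {μ : Measure ℝ | ∃ n, (αs n : Measure ℝ) = μ} := by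
  have hcomp := h.isCompact_insert_range
  refine (isTightMeasureSet_of_isCompact_closure
    (hcomp.isClosed.closure_eq.symm ▸ hcomp)).subset ?_
  rintro _ ⟨n, rfl⟩
  exact ⟨αs n, by simp, rfl⟩

/-- Couplings of convergent sequences of marginals are precompact, and the transport cost is lower
semicontinuous. -/
theorem exists_coupling_lintegral_le (hp : 0 ≤ p)
    (hc : LowerSemicontinuous (fun z : ℝ × ℝ => c z.1 z.2))
    {αs βs : ℕ → ProbabilityMeasure ℝ} {α β : ProbabilityMeasure ℝ}
    (hα : Tendsto αs atTop (𝓝 α)) (hβ : Tendsto βs atTop (𝓝 β)) {r : ℝ≥0∞}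
    (hr : ∀ n, wassersteinPow p c (αs n) (βs n) ≤ r) :
    ∃ π ∈ couplings α β, ∫⁻ z, (c z.1 z.2 : ℝ≥0∞) ^ p ∂π ≤ r := by
  rcases eq_or_ne r ∞ with rfl | hr_top
  · exact ⟨_, prod_mem_couplings _ _, le_top⟩
  -- Near-optimal couplings with vanishing slack; the strict inequality needs `r` finite.
  have hex : ∀ n : ℕ, ∃ π ∈ couplings (αs n : Measure ℝ) (βs n),
      ∫⁻ z, (c z.1 z.2 : ℝ≥0∞) ^ p ∂π < r + ((n : ℝ≥0∞) + 1)⁻¹ := fun n => by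
    have hlt : wassersteinPow p c (αs n) (βs n) < r + ((n : ℝ≥0∞) + 1)⁻¹ :=
      (hr n).trans_lt (ENNReal.lt_add_right hr_top (by simp))
    simpa only [wassersteinPow, iInf_lt_iff, exists_prop] using hlt
  choose π hπ hlt using hex
  have hprob : ∀ n, IsProbabilityMeasure (π n) := fun n =>
    isProbabilityMeasure_of_mem_couplings (hπ n)
  let P : ℕ → ProbabilityMeasure (ℝ × ℝ) := fun n => ⟨π n, hprob n⟩
  -- Couplings are tight as soon as both families of marginals are.
  have htight : IsTightMeasureSet
      {((μ : ProbabilityMeasure (ℝ × ℝ)) : Measure (ℝ × ℝ)) | μ ∈ range P} := by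
    refine IsTightMeasureSet.prodMk ?_ ?_
    · refine (isTightMeasureSet_range_of_tendsto hα).subset ?_
      rintro _ ⟨_, ⟨_, ⟨n, rfl⟩, rfl⟩, rfl⟩
      exact ⟨n, (hπ n).1.symm⟩
    · refine (isTightMeasureSet_range_of_tendsto hβ).subset ?_
      rintro _ ⟨_, ⟨_, ⟨n, rfl⟩, rfl⟩, rfl⟩
      exact ⟨n, (hπ n).2.symm⟩
  obtain ⟨Q, -, φ, hφ, hQ⟩ := (isCompact_closure_of_isTightMeasureSet htight).tendsto_subseq
    (x := P) fun n => subset_closure (mem_range_self n)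
  refine ⟨Q, ⟨?_, ?_⟩, ?_⟩
  · have h1 := ProbabilityMeasure.tendsto_map_of_tendsto_of_continuous _ _ hQ continuous_fst
    have h2 : (fun n => ((P ∘ φ) n).map continuous_fst.measurable.aemeasurable) = αs ∘ φ :=
      funext fun n => Subtype.ext (hπ (φ n)).1
    rw [h2] at h1
    exact congrArg ProbabilityMeasure.toMeasure (tendsto_nhds_unique h1 (hα.comp hφ.tendsto_atTop))
  · have h1 := ProbabilityMeasure.tendsto_map_of_tendsto_of_continuous _ _ hQ continuous_snd
    have h2 : (fun n => ((P ∘ φ) n).map continuous_snd.measurable.aemeasurable) = βs ∘ φ :=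
      funext fun n => Subtype.ext (hπ (φ n)).2
    rw [h2] at h1
    exact congrArg ProbabilityMeasure.toMeasure (tendsto_nhds_unique h1 (hβ.comp hφ.tendsto_atTop))
  · have hlim : Tendsto (fun n : ℕ => r + ((φ n : ℝ≥0∞) + 1)⁻¹) atTop (𝓝 r) := by
      have h0 : Tendsto (fun n : ℕ => ((n : ℝ≥0∞) + 1)⁻¹) atTop (𝓝 0) := by
        simpa using (tendsto_add_atTop_iff_nat 1).2 ENNReal.tendsto_inv_nat_nhds_zero
      simpa using (h0.comp hφ.tendsto_atTop).const_add r
    calc _ ≤ _ := lintegral_cost_le_liminf hp hc hQ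
      _ ≤ atTop.liminf (fun n : ℕ => r + ((φ n : ℝ≥0∞) + 1)⁻¹) :=
        liminf_le_liminf (Eventually.of_forall fun n => (hlt (φ n)).le)
      _ = r := hlim.liminf_eq

theorem exists_optimal_coupling (hp : 0 ≤ p)
    (hc : LowerSemicontinuous (fun z : ℝ × ℝ => c z.1 z.2))
    (μ ν : Measure ℝ) [hμ : IsProbabilityMeasure μ] [hν : IsProbabilityMeasure ν] :
    ∃ π ∈ couplings μ ν, ∫⁻ z, (c z.1 z.2 : ℝ≥0∞) ^ p ∂π = wassersteinPow p c μ ν := by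
  -- Constant marginals: the limit coupling is a minimiser.
  obtain ⟨π, hπ, hle⟩ := exists_coupling_lintegral_le (αs := fun _ => ⟨μ, hμ⟩)
    (βs := fun _ => ⟨ν, hν⟩) hp hc tendsto_const_nhds tendsto_const_nhds (fun _ => le_rfl)
  exact ⟨π, hπ, hle.antisymm (wassersteinPow_le hπ)⟩

theorem wassersteinPow_self (hp : 0 < p) (hc : IsMetric c) (μ : Measure ℝ)
    (hc_lsc : LowerSemicontinuous (fun z : ℝ × ℝ => c z.1 z.2)) :
    wassersteinPow p c μ μ = 0 := by
  have hdiag : Measurable fun x : ℝ => (x, x) := by fun_prop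
  have hmem : μ.map (fun x => (x, x)) ∈ couplings μ μ := ⟨?_, ?_⟩
  · refine le_antisymm ((wassersteinPow_le hmem).trans ?_) zero_le
    rw [lintegral_map ((measurable_cost hc_lsc).pow_const p) hdiag]
    simp [(hc.eq_zero_iff _ _).2, hp]
  · rw [Measure.map_map measurable_fst hdiag]; exact Measure.map_id
  · rw [Measure.map_map measurable_snd hdiag]; exact Measure.map_id

/-- An optimal coupling of cost zero lives on the diagonal, where both projections coincide. -/
theorem eq_of_wassersteinPow_eq_zero (hp : 0 < p) (hc : IsMetric c)
    (hc_lsc : LowerSemicontinuous (fun z : ℝ × ℝ => c z.1 z.2))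
    {μ ν : Measure ℝ} [IsProbabilityMeasure μ] [IsProbabilityMeasure ν]
    (h : wassersteinPow p c μ ν = 0) : μ = ν := by
  obtain ⟨π, hπ, hle⟩ := exists_optimal_coupling hp.le hc_lsc μ ν
  rw [h, lintegral_eq_zero_iff ((measurable_cost hc_lsc).pow_const p)] at hle
  rw [← hπ.1, ← hπ.2]
  refine Measure.map_congr ?_
  filter_upwards [hle] with z hz
  have : c z.1 z.2 = 0 := by simpa [hp, hp.le, not_lt.2 hp.le] using hz
  exact (hc.eq_zero_iff _ _).1 this

theorem wassersteinPow_le_swap (hc : IsMetric c)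
    (hc_lsc : LowerSemicontinuous (fun z : ℝ × ℝ => c z.1 z.2)) (μ ν : Measure ℝ) :
    wassersteinPow p c μ ν ≤ wassersteinPow p c ν μ := by
  refine le_iInf₂ fun π hπ => ?_
  have hmem : π.map Prod.swap ∈ couplings μ ν := ⟨?_, ?_⟩
  · refine (wassersteinPow_le hmem).trans_eq ?_
    rw [lintegral_map ((measurable_cost hc_lsc).pow_const p) measurable_swap]
    simp [hc.symm]
  · rw [Measure.map_map measurable_fst measurable_swap]; exact hπ.2
  · rw [Measure.map_map measurable_snd measurable_swap]; exact hπ.1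

theorem wassersteinPow_comm (hc : IsMetric c)
    (hc_lsc : LowerSemicontinuous (fun z : ℝ × ℝ => c z.1 z.2)) (μ ν : Measure ℝ) :
    wassersteinPow p c μ ν = wassersteinPow p c ν μ :=
  (wassersteinPow_le_swap hc hc_lsc μ ν).antisymm (wassersteinPow_le_swap hc hc_lsc ν μ)

/-- The gluing lemma: two measures with the same first marginal have a common extension. -/
theorem exists_gluing (π₁ π₂ : Measure (ℝ × ℝ)) [IsFiniteMeasure π₁] [IsFiniteMeasure π₂]
    (h : π₁.map Prod.fst = π₂.map Prod.fst) :
    ∃ κ : Measure (ℝ × ℝ × ℝ), κ.map (fun z => (z.1, z.2.1)) = π₁ ∧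
      κ.map (fun z => (z.1, z.2.2)) = π₂ := by
  -- The second coordinates are taken conditionally independent given the shared first one.
  refine ⟨π₁.fst ⊗ₘ (π₁.condKernel ×ₖ π₂.condKernel), ?_, ?_⟩
  · have h1 := Measure.compProd_map (μ := π₁.fst)
      (κ := π₁.condKernel ×ₖ π₂.condKernel) measurable_fst
    rw [← Kernel.fst_eq, Kernel.fst_prod, Measure.disintegrate] at h1
    exact h1.symm
  · have h1 := Measure.compProd_map (μ := π₁.fst)
      (κ := π₁.condKernel ×ₖ π₂.condKernel) measurable_snd
    rw [← Kernel.snd_eq, Kernel.snd_prod, show π₁.fst = π₂.fst from h,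
      Measure.disintegrate] at h1
    rw [show π₁.fst = π₂.fst from h]
    exact h1.symm

theorem wassersteinPow_triangle (hp : 1 ≤ p) (hc : IsMetric c)
    (hc_lsc : LowerSemicontinuous (fun z : ℝ × ℝ => c z.1 z.2))
    (μ₁ μ₂ μ₃ : Measure ℝ) [IsProbabilityMeasure μ₁] [IsProbabilityMeasure μ₂]
    [IsProbabilityMeasure μ₃] :
    wassersteinPow p c μ₁ μ₃ ^ (1 / p) ≤
      wassersteinPow p c μ₁ μ₂ ^ (1 / p) + wassersteinPow p c μ₂ μ₃ ^ (1 / p) := by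
  have hp0 : 0 ≤ p := zero_le_one.trans hp
  -- Puts `μ₂` first in both couplings, as gluing requires.
  rw [wassersteinPow_comm hc hc_lsc μ₁ μ₂]
  obtain ⟨π₁, hπ₁, h₁⟩ := exists_optimal_coupling hp0 hc_lsc μ₂ μ₁
  obtain ⟨π₂, hπ₂, h₂⟩ := exists_optimal_coupling hp0 hc_lsc μ₂ μ₃
  have := isProbabilityMeasure_of_mem_couplings hπ₁
  have := isProbabilityMeasure_of_mem_couplings hπ₂
  obtain ⟨κ, hκ₁, hκ₂⟩ := exists_gluing π₁ π₂ (hπ₁.1.trans hπ₂.1.symm)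
  have hm₁ : Measurable fun z : ℝ × ℝ × ℝ => (z.1, z.2.1) := by fun_prop
  have hm₂ : Measurable fun z : ℝ × ℝ × ℝ => (z.1, z.2.2) := by fun_prop
  have hcost := measurable_cost hc_lsc
  have hκ : κ.map Prod.snd ∈ couplings μ₁ μ₃ := by
    constructor
    · rw [Measure.map_map measurable_fst measurable_snd, ← hπ₁.2, ← hκ₁,
        Measure.map_map measurable_snd hm₁]
      rfl
    · rw [Measure.map_map measurable_snd measurable_snd, ← hπ₂.2, ← hκ₂,
        Measure.map_map measurable_snd hm₂]
      rfl
  rw [← h₁, ← h₂, ← hκ₁, ← hκ₂, lintegral_map (hcost.pow_const p) hm₁,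
    lintegral_map (hcost.pow_const p) hm₂]
  refine le_trans ?_ (ENNReal.lintegral_Lp_add_le (hcost.comp hm₁).aemeasurable
    (hcost.comp hm₂).aemeasurable hp)
  refine ENNReal.rpow_le_rpow ((wassersteinPow_le hκ).trans ?_) (by positivity)
  rw [lintegral_map (hcost.pow_const p) measurable_snd]
  refine lintegral_mono fun z => ENNReal.rpow_le_rpow ?_ hp0
  have := hc.triangle z.2.1 z.1 z.2.2
  rw [hc.symm z.2.1 z.1] at this
  simp only [Pi.add_apply]
  exact_mod_cast this

theorem isClosed_wassersteinPow_le (hp : 0 ≤ p)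
    (hc : LowerSemicontinuous (fun z : ℝ × ℝ => c z.1 z.2)) (r : ℝ≥0∞) :
    IsClosed {q : ProbabilityMeasure ℝ × ProbabilityMeasure ℝ |
      wassersteinPow p c q.1 q.2 ≤ r} := by
  refine IsSeqClosed.isClosed fun q q₀ hq hlim => ?_
  obtain ⟨π, hπ, hle⟩ := exists_coupling_lintegral_le hp hc
    ((continuous_fst.tendsto q₀).comp hlim) ((continuous_snd.tendsto q₀).comp hlim) hq
  exact (wassersteinPow_le hπ).trans hle

end Wasserstein

/-! ### Normalised reference measures -/

section UniformLaw

variable {Ω : Type*} [MeasurableSpace Ω] [TopologicalSpace Ω] (m : Measure Ω)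

theorem isOpenPosMeasure_uniformLaw [IsFiniteMeasure m] [m.IsOpenPosMeasure] :
    (uniformLaw m).IsOpenPosMeasure where
  open_pos U hU hne := by
    simp [uniformLaw, measure_ne_top m univ, hU.measure_ne_zero m hne]

theorem isFiniteMeasure_uniformLaw [Nonempty Ω] [IsFiniteMeasure m] [m.IsOpenPosMeasure] :
    IsFiniteMeasure (uniformLaw m) :=
  Measure.smul_finite _ (by simp [NeZero.ne m])

end UniformLaw

/-! ### Full support of the slicing law -/

section SlicingLaw

variable {Ω₁ Ω₂ : Type*} [TopologicalSpace Ω₁] [MeasurableSpace Ω₁] [Nonempty Ω₁]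
  [TopologicalSpace Ω₂] [MeasurableSpace Ω₂] [Nonempty Ω₂]
  (m₁ : Measure Ω₁) (m₂ : Measure Ω₂) [m₁.IsOpenPosMeasure] [m₂.IsOpenPosMeasure]

instance : Nonempty Circ := (NormedSpace.sphere_nonempty.2 zero_le_one).to_subtype

theorem isFiniteMeasure_uniformCirc : IsFiniteMeasure uniformCirc :=
  isFiniteMeasure_uniformLaw _

theorem isOpenPosMeasure_slicingLaw [IsFiniteMeasure m₁] [IsFiniteMeasure m₂] :
    (slicingLaw m₁ m₂).IsOpenPosMeasure := by
  have := isFiniteMeasure_uniformLaw m₁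
  have := isFiniteMeasure_uniformLaw m₂
  have := isFiniteMeasure_uniformCirc
  have := isOpenPosMeasure_uniformLaw m₁
  have := isOpenPosMeasure_uniformLaw m₂
  have : uniformCirc.IsOpenPosMeasure := isOpenPosMeasure_uniformLaw _
  have h := Measure.prod.instIsOpenPosMeasure (μ := uniformLaw m₂) (ν := uniformCirc)
  exact Measure.prod.instIsOpenPosMeasure (μ := uniformLaw m₁)
    (ν := (uniformLaw m₂).prod uniformCirc)

end SlicingLaw

/-! ### From one-dimensional images back to the measure -/

section Injectivity

/-- On the class `S`, a finite measure is determined by its images under all `g(·, θ)`. -/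
def Determines {d : ℕ} {Ω : Type*} (g : E d → Ω → ℝ) (S : Set (Measure (E d))) : Prop :=
  ∀ ρ ∈ S, ∀ ρ' ∈ S, IsFiniteMeasure ρ → IsFiniteMeasure ρ' →
    (∀ θ, ρ.map (fun x => g x θ) = ρ'.map (fun x => g x θ)) → ρ = ρ'

variable {d : ℕ} {Ω : Type*} {g : E d → Ω → ℝ}

theorem GRT_toSignedMeasure_congr (hg : ∀ θ, Measurable (fun x => g x θ)) (ρ ρ' : Measure (E d))
    [IsFiniteMeasure ρ] [IsFiniteMeasure ρ'] (θ : Ω)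
    (h : ρ.map (fun x => g x θ) = ρ'.map (fun x => g x θ)) :
    GRT g ρ.toSignedMeasure θ = GRT g ρ'.toSignedMeasure θ := by
  ext s hs
  have hs' := hg θ hs
  rw [GRT, GRT, VectorMeasure.map_apply _ (hg θ) hs, VectorMeasure.map_apply _ (hg θ) hs,
    Measure.toSignedMeasure_apply_measurable hs', Measure.toSignedMeasure_apply_measurable hs',
    ← map_measureReal_apply (hg θ) hs, h, map_measureReal_apply (hg θ) hs]

theorem GRTInjective.determines (h : GRTInjective g) (hg : ∀ θ, Measurable (fun x => g x θ)) :
    Determines g univ := by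
  intro ρ _ ρ' _ _ _ hmap
  exact Measure.toSignedMeasure_eq_toSignedMeasure_iff.1
    (h (funext fun θ => GRT_toSignedMeasure_congr hg ρ ρ' θ (hmap θ)))

theorem withDensityᵥ_rnDeriv_toReal {X : Type*} [MeasurableSpace X] {ρ l : Measure X}
    [IsFiniteMeasure ρ] [SigmaFinite l] (h : ρ ≪ l) :
    l.withDensityᵥ (fun x => (ρ.rnDeriv l x).toReal) = ρ.toSignedMeasure := by
  rw [withDensityᵥ_toReal (Measure.measurable_rnDeriv ρ l).aemeasurable
    (Measure.lintegral_rnDeriv_lt_top ρ l).ne]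
  exact Measure.toSignedMeasure_congr (Measure.withDensity_rnDeriv_eq ρ l h)

/-- Radon–Nikodym derivatives turn absolutely continuous measures into `L¹` functions. -/
theorem GRTInjectiveL1.determines (h : GRTInjectiveL1 g)
    (hg : ∀ θ, Measurable (fun x => g x θ)) : Determines g {ρ | ρ ≪ volume} := by
  intro ρ hρ ρ' hρ' _ _ hmap
  have hae := h _ _ (Measure.integrable_toReal_rnDeriv (μ := ρ) (ν := volume))
    (Measure.integrable_toReal_rnDeriv (μ := ρ') (ν := volume)) fun θ => by
      rw [withDensityᵥ_rnDeriv_toReal hρ, withDensityᵥ_rnDeriv_toReal hρ']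
      exact GRT_toSignedMeasure_congr hg ρ ρ' θ (hmap θ)
  rw [← Measure.toSignedMeasure_eq_toSignedMeasure_iff, ← withDensityᵥ_rnDeriv_toReal hρ,
    ← withDensityᵥ_rnDeriv_toReal hρ']
  exact WithDensityᵥEq.congr_ae hae

/-- The Cramér–Wold theorem in the plane, with directions restricted to the unit circle. -/
theorem map_prodMk_eq_of_forall_circ {X : Type*} [MeasurableSpace X] {μ ν : Measure X}
    [IsFiniteMeasure μ] [IsFiniteMeasure ν] {u v : X → ℝ} (hu : Measurable u) (hv : Measurable v)
    (h : ∀ ψ : Circ, μ.map (fun x => ψ.1 0 * u x + ψ.1 1 * v x) =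
      ν.map (fun x => ψ.1 0 * u x + ψ.1 1 * v x)) :
    μ.map (fun x => (u x, v x)) = ν.map (fun x => (u x, v x)) := by
  have huv : Measurable fun x => (u x, v x) := hu.prodMk hv
  refine Measure.ext_of_charFunDual (funext fun L => ?_)
  -- Polar coordinates of the functional: its characteristic function value is that of the slice in
  -- direction `ψ` at frequency `r`. For `L = 0` any direction serves.
  obtain ⟨ψ, r, h0, h1⟩ : ∃ ψ : Circ, ∃ r : ℝ, L (1, 0) = r * ψ.1 0 ∧ L (0, 1) = r * ψ.1 1 := by
    let w : EuclideanSpace ℝ (Fin 2) := !₂[L (1, 0), L (0, 1)]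
    rcases eq_or_ne w 0 with hw | hw
    · have h0 : L (1, 0) = 0 := congrArg (fun a : EuclideanSpace ℝ (Fin 2) => a 0) hw
      have h1 : L (0, 1) = 0 := congrArg (fun a : EuclideanSpace ℝ (Fin 2) => a 1) hw
      exact ⟨Classical.arbitrary _, 0, by simp [h0], by simp [h1]⟩
    · have hn : ‖w‖ ≠ 0 := norm_ne_zero_iff.2 hw
      refine ⟨⟨‖w‖⁻¹ • w, by simp [norm_smul, hn]⟩, ‖w‖, ?_, ?_⟩
      · simp [mul_inv_cancel_left₀ hn, w]
      · simp [mul_inv_cancel_left₀ hn, w]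
  have hL : ∀ x, L (u x, v x) = r * (ψ.1 0 * u x + ψ.1 1 * v x) := fun x => by
    have : (u x, v x) = u x • ((1 : ℝ), (0 : ℝ)) + v x • ((0 : ℝ), (1 : ℝ)) := by simp
    rw [this, map_add, map_smul, map_smul, h0, h1, smul_eq_mul, smul_eq_mul]
    ring
  have hψ : Measurable fun x => ψ.1 0 * u x + ψ.1 1 * v x := by fun_prop
  have key : ∀ ρ : Measure X, charFunDual (ρ.map fun x => (u x, v x)) L =
      ∫ t : ℝ, Complex.exp ((r * t : ℝ) * Complex.I) ∂(ρ.map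
        fun x => ψ.1 0 * u x + ψ.1 1 * v x) := fun ρ => by
    rw [charFunDual_apply, integral_map huv.aemeasurable (by fun_prop),
      integral_map hψ.aemeasurable (by fun_prop)]
    simp_rw [hL]
  rw [key, key, h ψ]

/-- With `t` fixed, `s ↦ μ (s ×ˢ t)` is a finite measure, the first marginal of a restriction of
`μ`; this is why the classes must contain marginals of restrictions. Rectangles of preimages are
known; one factor at a time is freed. -/
theorem eq_of_map_prod_eq {d₁ d₂ : ℕ} {Ω₁ Ω₂ : Type*} {g₁ : E d₁ → Ω₁ → ℝ} {g₂ : E d₂ → Ω₂ → ℝ}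
    (hg₁ : ∀ θ, Measurable (fun x => g₁ x θ)) (hg₂ : ∀ θ, Measurable (fun x => g₂ x θ))
    {S₁ : Set (Measure (E d₁))} {S₂ : Set (Measure (E d₂))}
    (h₁ : Determines g₁ S₁) (h₂ : Determines g₂ S₂)
    {μ ν : Measure (E d₁ × E d₂)} [IsFiniteMeasure μ] [IsFiniteMeasure ν]
    (hμ₁ : ∀ s, (μ.restrict s).map Prod.fst ∈ S₁) (hν₁ : ∀ s, (ν.restrict s).map Prod.fst ∈ S₁)
    (hμ₂ : ∀ s, (μ.restrict s).map Prod.snd ∈ S₂) (hν₂ : ∀ s, (ν.restrict s).map Prod.snd ∈ S₂)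
    (h : ∀ θ₁ θ₂, μ.map (fun x => (g₁ x.1 θ₁, g₂ x.2 θ₂)) =
      ν.map (fun x => (g₁ x.1 θ₁, g₂ x.2 θ₂))) : μ = ν := by
  have hrect : ∀ θ₁ θ₂ (s t : Set ℝ), MeasurableSet s → MeasurableSet t →
      μ (((fun x => g₁ x θ₁) ⁻¹' s) ×ˢ ((fun x => g₂ x θ₂) ⁻¹' t)) =
      ν (((fun x => g₁ x θ₁) ⁻¹' s) ×ˢ ((fun x => g₂ x θ₂) ⁻¹' t)) := by
    intro θ₁ θ₂ s t hs ht
    have hm : Measurable fun x : E d₁ × E d₂ => (g₁ x.1 θ₁, g₂ x.2 θ₂) :=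
      ((hg₁ θ₁).comp measurable_fst).prodMk ((hg₂ θ₂).comp measurable_snd)
    have := congrArg (fun m => m (s ×ˢ t)) (h θ₁ θ₂)
    simp only [Measure.map_apply hm (hs.prod ht)] at this
    exact this
  have hfst : ∀ (ρ : Measure (E d₁ × E d₂)) (s : Set (E d₁)) (t : Set (E d₂)), MeasurableSet s →
      (ρ.restrict (Prod.snd ⁻¹' t)).map Prod.fst s = ρ (s ×ˢ t) := fun ρ s t hs => by
    rw [Measure.map_apply measurable_fst hs, Measure.restrict_apply (measurable_fst hs)]
    rfl
  have hsnd : ∀ (ρ : Measure (E d₁ × E d₂)) (s : Set (E d₁)) (t : Set (E d₂)), MeasurableSet t →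
      (ρ.restrict (Prod.fst ⁻¹' s)).map Prod.snd t = ρ (s ×ˢ t) := fun ρ s t ht => by
    rw [Measure.map_apply measurable_snd ht, Measure.restrict_apply (measurable_snd ht),
      inter_comm]
    rfl
  -- The first factor is now arbitrary; the second is still a preimage under `g₂(·, θ₂)`.
  have step : ∀ θ₂ (t : Set ℝ), MeasurableSet t → ∀ s : Set (E d₁), MeasurableSet s →
      μ (s ×ˢ ((fun x => g₂ x θ₂) ⁻¹' t)) = ν (s ×ˢ ((fun x => g₂ x θ₂) ⁻¹' t)) := by
    intro θ₂ t ht s hs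
    rw [← hfst μ _ _ hs, ← hfst ν _ _ hs]
    congr 1
    refine h₁ _ (hμ₁ _) _ (hν₁ _) inferInstance inferInstance fun θ₁ => ?_
    ext s' hs'
    rw [Measure.map_apply (hg₁ θ₁) hs', Measure.map_apply (hg₁ θ₁) hs', hfst _ _ _ (hg₁ θ₁ hs'),
      hfst _ _ _ (hg₁ θ₁ hs')]
    exact hrect θ₁ θ₂ s' t hs' ht
  refine Measure.ext_prod fun {s t} hs ht => ?_
  rw [← hsnd μ _ _ ht, ← hsnd ν _ _ ht]
  congr 1
  refine h₂ _ (hμ₂ _) _ (hν₂ _) inferInstance inferInstance fun θ₂ => ?_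
  ext t' ht'
  rw [Measure.map_apply (hg₂ θ₂) ht', Measure.map_apply (hg₂ θ₂) ht', hsnd _ _ _ (hg₂ θ₂ ht'),
    hsnd _ _ _ (hg₂ θ₂ ht')]
  exact step θ₂ t' ht' s hs

end Injectivity

/-! ### Dependence of the slices on the parameter -/

section Slice

variable {d₁ d₂ : ℕ} {Ω₁ Ω₂ : Type*} {g₁ : E d₁ → Ω₁ → ℝ} {g₂ : E d₂ → Ω₂ → ℝ}

theorem measurable_slice [MeasurableSpace Ω₁] [MeasurableSpace Ω₂]
    (hg₁ : ∀ θ, Measurable (fun x => g₁ x θ)) (hg₂ : ∀ θ, Measurable (fun x => g₂ x θ))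
    (ω : Ω₁ × Ω₂ × Circ) : Measurable (slice g₁ g₂ ω) :=
  (((hg₁ ω.1).comp measurable_fst).const_mul _).add
    (((hg₂ ω.2.1).comp measurable_snd).const_mul _)

theorem continuous_slice [TopologicalSpace Ω₁] [TopologicalSpace Ω₂]
    [MeasurableSpace Ω₁] [MeasurableSpace Ω₂]
    (hg₁ : ∀ x, Continuous (g₁ x)) (hg₂ : ∀ x, Continuous (g₂ x)) (x : E d₁ × E d₂) :
    Continuous fun ω => slice g₁ g₂ ω x := by
  have h₁ := hg₁ x.1
  have h₂ := hg₂ x.2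
  unfold slice
  fun_prop

/-- The image of `μ` under the slicing map, as a probability measure. -/
noncomputable def sliceLaw [MeasurableSpace Ω₁] [MeasurableSpace Ω₂]
    (hg₁ : ∀ θ, Measurable (fun x => g₁ x θ)) (hg₂ : ∀ θ, Measurable (fun x => g₂ x θ))
    (μ : ProbabilityMeasure (E d₁ × E d₂)) (ω : Ω₁ × Ω₂ × Circ) : ProbabilityMeasure ℝ :=
  μ.map (measurable_slice hg₁ hg₂ ω).aemeasurable

theorem isProbabilityMeasure_HHR [MeasurableSpace Ω₁] [MeasurableSpace Ω₂]
    (hg₁_meas : ∀ θ, Measurable (fun x => g₁ x θ)) (hg₂_meas : ∀ θ, Measurable (fun x => g₂ x θ))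
    (ω : Ω₁ × Ω₂ × Circ) (μ : ProbabilityMeasure (E d₁ × E d₂)) :
    IsProbabilityMeasure (HHR g₁ g₂ ω μ) :=
  (sliceLaw hg₁_meas hg₂_meas μ ω).2

/-- Dominated convergence, tested on bounded continuous functions. -/
theorem continuous_sliceLaw
    [TopologicalSpace Ω₁] [FirstCountableTopology Ω₁] [MeasurableSpace Ω₁]
    [TopologicalSpace Ω₂] [FirstCountableTopology Ω₂] [MeasurableSpace Ω₂]
    (hg₁_meas : ∀ θ, Measurable (fun x => g₁ x θ)) (hg₁_cont : ∀ x, Continuous (g₁ x))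
    (hg₂_meas : ∀ θ, Measurable (fun x => g₂ x θ)) (hg₂_cont : ∀ x, Continuous (g₂ x))
    (μ : ProbabilityMeasure (E d₁ × E d₂)) : Continuous (sliceLaw hg₁_meas hg₂_meas μ) := by
  refine ProbabilityMeasure.continuous_iff_forall_continuous_integral.2 fun f => ?_
  have hmap : ∀ ω, ∫ t, f t ∂(sliceLaw hg₁_meas hg₂_meas μ ω : Measure ℝ) =
      ∫ x, f (slice g₁ g₂ ω x) ∂(μ : Measure (E d₁ × E d₂)) := fun ω =>
    integral_map (measurable_slice hg₁_meas hg₂_meas ω).aemeasurable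
      f.continuous.aestronglyMeasurable
  simp_rw [hmap]
  refine continuous_of_dominated (bound := fun _ => ‖f‖) (fun ω => ?_)
    (fun ω => Eventually.of_forall fun x => f.norm_coe_le_norm _) (integrable_const _)
    (Eventually.of_forall fun x => f.continuous.comp (continuous_slice hg₁_cont hg₂_cont x))
  exact (f.continuous.measurable.comp
    (measurable_slice hg₁_meas hg₂_meas ω)).aestronglyMeasurable

variable [TopologicalSpace Ω₁] [TopologicalSpace.MetrizableSpace Ω₁]
  [MeasurableSpace Ω₁] [BorelSpace Ω₁]
  [TopologicalSpace Ω₂] [TopologicalSpace.MetrizableSpace Ω₂] [SecondCountableTopology Ω₂]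
  [MeasurableSpace Ω₂] [BorelSpace Ω₂]

theorem measurable_wassersteinPow_HHR {p : ℝ} (hp : 0 ≤ p) {c : ℝ → ℝ → ℝ≥0}
    (hc : LowerSemicontinuous (fun z : ℝ × ℝ => c z.1 z.2))
    (hg₁_meas : ∀ θ, Measurable (fun x => g₁ x θ)) (hg₁_cont : ∀ x, Continuous (g₁ x))
    (hg₂_meas : ∀ θ, Measurable (fun x => g₂ x θ)) (hg₂_cont : ∀ x, Continuous (g₂ x))
    (μ ν : ProbabilityMeasure (E d₁ × E d₂)) :
    Measurable fun ω => wassersteinPow p c (HHR g₁ g₂ ω μ) (HHR g₁ g₂ ω ν) := by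
  refine measurable_of_Iic fun r => IsClosed.measurableSet ?_
  exact (isClosed_wassersteinPow_le hp hc r).preimage
    ((continuous_sliceLaw hg₁_meas hg₁_cont hg₂_meas hg₂_cont μ).prodMk
      (continuous_sliceLaw hg₁_meas hg₁_cont hg₂_meas hg₂_cont ν))

variable [SecondCountableTopology Ω₁]

/-- A Carathéodory function is jointly measurable; this makes the sliced moments measurable in `ω`.
-/
theorem measurable_uncurry_slice
    (hg₁_meas : ∀ θ, Measurable (fun x => g₁ x θ)) (hg₁_cont : ∀ x, Continuous (g₁ x))
    (hg₂_meas : ∀ θ, Measurable (fun x => g₂ x θ)) (hg₂_cont : ∀ x, Continuous (g₂ x)) :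
    Measurable (Function.uncurry (slice g₁ g₂)) :=
  measurable_uncurry_of_continuous_of_measurable (continuous_slice hg₁_cont hg₂_cont)
    (measurable_slice hg₁_meas hg₂_meas)

end Slice

/-! ### Metric axioms and finiteness -/

section Metric

variable {d₁ d₂ : ℕ} {Ω₁ Ω₂ : Type*}
  [TopologicalSpace Ω₁] [TopologicalSpace.MetrizableSpace Ω₁] [MeasurableSpace Ω₁] [BorelSpace Ω₁]
  [TopologicalSpace Ω₂] [TopologicalSpace.MetrizableSpace Ω₂] [SecondCountableTopology Ω₂]
  [MeasurableSpace Ω₂] [BorelSpace Ω₂]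
  (m₁ : Measure Ω₁) (m₂ : Measure Ω₂)
  {p : ℝ} {c : ℝ → ℝ → ℝ≥0} {g₁ : E d₁ → Ω₁ → ℝ} {g₂ : E d₂ → Ω₂ → ℝ}


theorem h2sw_triangle (hp : 1 ≤ p) (hc : IsMetric c)
    (hc_lsc : LowerSemicontinuous (fun z : ℝ × ℝ => c z.1 z.2))
    (hg₁_meas : ∀ θ, Measurable (fun x => g₁ x θ)) (hg₁_cont : ∀ x, Continuous (g₁ x))
    (hg₂_meas : ∀ θ, Measurable (fun x => g₂ x θ)) (hg₂_cont : ∀ x, Continuous (g₂ x))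
    (μ₁ μ₂ μ₃ : ProbabilityMeasure (E d₁ × E d₂)) :
    h2sw p c m₁ m₂ g₁ g₂ μ₁ μ₃ ≤ h2sw p c m₁ m₂ g₁ g₂ μ₁ μ₂ + h2sw p c m₁ m₂ g₁ g₂ μ₂ μ₃ := by
  have hp0 : 0 < p := zero_lt_one.trans_le hp
  have hmeas := measurable_wassersteinPow_HHR hp0.le hc_lsc hg₁_meas hg₁_cont hg₂_meas hg₂_cont
  have hprob := isProbabilityMeasure_HHR hg₁_meas hg₂_meas
  have hmink := ENNReal.lintegral_Lp_add_le (μ := slicingLaw m₁ m₂)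
    ((hmeas μ₁ μ₂).pow_const (1 / p)).aemeasurable
    ((hmeas μ₂ μ₃).pow_const (1 / p)).aemeasurable hp
  -- Minkowski is applied to the distances themselves, the `1 / p`-th powers of the costs.
  have hpow : ∀ x : ℝ≥0∞, (x ^ (1 / p)) ^ p = x := fun x => by
    rw [← ENNReal.rpow_mul, one_div_mul_cancel hp0.ne', ENNReal.rpow_one]
  simp only [Pi.add_apply, hpow] at hmink
  refine le_trans (ENNReal.rpow_le_rpow (lintegral_mono fun ω => ?_) (by positivity)) hmink
  have := hprob ω μ₁
  have := hprob ω μ₂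
  have := hprob ω μ₃
  rw [← hpow (wassersteinPow p c (HHR g₁ g₂ ω μ₁) (HHR g₁ g₂ ω μ₃))]
  exact ENNReal.rpow_le_rpow (wassersteinPow_triangle hp hc hc_lsc _ _ _) hp0.le

/-- Product coupling and the triangle inequality through `0`; the factor `2 ^ (p - 1)` is convexity
of the `p`-th power. -/
theorem wassersteinPow_le_moments (hp : 1 ≤ p) (hc : IsMetric c)
    (hc_lsc : LowerSemicontinuous (fun z : ℝ × ℝ => c z.1 z.2)) (α β : Measure ℝ)
    [IsProbabilityMeasure α] [IsProbabilityMeasure β] :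
    wassersteinPow p c α β ≤ 2 ^ (p - 1) *
      (∫⁻ t, (c 0 t : ℝ≥0∞) ^ p ∂α + ∫⁻ t, (c 0 t : ℝ≥0∞) ^ p ∂β) := by
  have hmeas : Measurable fun t : ℝ => (c 0 t : ℝ≥0∞) ^ p :=
    ((measurable_cost hc_lsc).comp measurable_prodMk_left).pow_const p
  have htwo : (2 : ℝ≥0∞) ^ (p - 1) ≠ ∞ :=
    ENNReal.rpow_ne_top_of_nonneg (by linarith) (by simp)
  calc wassersteinPow p c α β
      ≤ ∫⁻ z, (c z.1 z.2 : ℝ≥0∞) ^ p ∂(α.prod β) := wassersteinPow_le (prod_mem_couplings α β)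
    _ ≤ ∫⁻ z, 2 ^ (p - 1) * ((c 0 z.1 : ℝ≥0∞) ^ p + (c 0 z.2 : ℝ≥0∞) ^ p) ∂(α.prod β) := by
        refine lintegral_mono fun z => ?_
        have htri := hc.triangle z.1 0 z.2
        rw [hc.symm z.1 0] at htri
        refine (ENNReal.rpow_le_rpow ?_ (zero_le_one.trans hp)).trans
          (ENNReal.rpow_add_le_mul_rpow_add_rpow _ _ hp)
        exact_mod_cast htri
    _ = _ := by
        have hfst : Measurable fun z : ℝ × ℝ => (c 0 z.1 : ℝ≥0∞) ^ p := hmeas.comp measurable_fst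
        rw [lintegral_const_mul' _ _ htwo, lintegral_add_left hfst,
          ← lintegral_map hmeas measurable_fst, ← lintegral_map hmeas measurable_snd,
          (prod_mem_couplings α β).1, (prod_mem_couplings α β).2]

theorem h2sw_lt_top [SecondCountableTopology Ω₁] (hp : 1 ≤ p) (hc : IsMetric c)
    (hc_lsc : LowerSemicontinuous (fun z : ℝ × ℝ => c z.1 z.2))
    (hg₁_meas : ∀ θ, Measurable (fun x => g₁ x θ)) (hg₁_cont : ∀ x, Continuous (g₁ x))
    (hg₂_meas : ∀ θ, Measurable (fun x => g₂ x θ)) (hg₂_cont : ∀ x, Continuous (g₂ x))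
    {μ ν : ProbabilityMeasure (E d₁ × E d₂)}
    (hμ : HasFiniteMoment p c m₁ m₂ g₁ g₂ μ) (hν : HasFiniteMoment p c m₁ m₂ g₁ g₂ ν) :
    h2sw p c m₁ m₂ g₁ g₂ μ ν < ∞ := by
  have hmeas : Measurable fun t : ℝ => (c 0 t : ℝ≥0∞) ^ p :=
    ((measurable_cost hc_lsc).comp measurable_prodMk_left).pow_const p
  have hprob := isProbabilityMeasure_HHR hg₁_meas hg₂_meas
  have hslice := measurable_uncurry_slice hg₁_meas hg₁_cont hg₂_meas hg₂_cont
  have hinner : ∀ ρ : ProbabilityMeasure (E d₁ × E d₂), Measurable fun ω =>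
      ∫⁻ x, (c 0 (slice g₁ g₂ ω x) : ℝ≥0∞) ^ p ∂(ρ : Measure (E d₁ × E d₂)) := fun ρ =>
    (hmeas.comp hslice).lintegral_prod_right'
  refine ENNReal.rpow_lt_top_of_nonneg (by positivity) (ne_of_lt ?_)
  calc ∫⁻ ω, wassersteinPow p c (HHR g₁ g₂ ω μ) (HHR g₁ g₂ ω ν) ∂(slicingLaw m₁ m₂)
      ≤ ∫⁻ ω, 2 ^ (p - 1) *
        (∫⁻ x, (c 0 (slice g₁ g₂ ω x) : ℝ≥0∞) ^ p ∂(μ : Measure (E d₁ × E d₂)) +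
          ∫⁻ x, (c 0 (slice g₁ g₂ ω x) : ℝ≥0∞) ^ p ∂(ν : Measure (E d₁ × E d₂)))
        ∂(slicingLaw m₁ m₂) := by
        refine lintegral_mono fun ω => ?_
        have := hprob ω μ
        have := hprob ω ν
        refine (wassersteinPow_le_moments hp hc hc_lsc _ _).trans_eq ?_
        rw [HHR, HHR, lintegral_map hmeas (measurable_slice hg₁_meas hg₂_meas ω),
          lintegral_map hmeas (measurable_slice hg₁_meas hg₂_meas ω)]
    _ < ∞ := by
        have htwo : (2 : ℝ≥0∞) ^ (p - 1) ≠ ∞ :=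
          ENNReal.rpow_ne_top_of_nonneg (by linarith) (by simp)
        rw [lintegral_const_mul' _ _ htwo, lintegral_add_left (hinner μ)]
        exact ENNReal.mul_lt_top htwo.lt_top
          (ENNReal.add_lt_top.2 ⟨hμ, hν⟩)

variable [Nonempty Ω₁] [IsFiniteMeasure m₁] [m₁.IsOpenPosMeasure]
  [Nonempty Ω₂] [IsFiniteMeasure m₂] [m₂.IsOpenPosMeasure]

theorem HHR_eq_of_h2sw_eq_zero (hp : 1 ≤ p) (hc : IsMetric c)
    (hc_lsc : LowerSemicontinuous (fun z : ℝ × ℝ => c z.1 z.2))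
    (hg₁_meas : ∀ θ, Measurable (fun x => g₁ x θ)) (hg₁_cont : ∀ x, Continuous (g₁ x))
    (hg₂_meas : ∀ θ, Measurable (fun x => g₂ x θ)) (hg₂_cont : ∀ x, Continuous (g₂ x))
    {μ ν : ProbabilityMeasure (E d₁ × E d₂)} (h : h2sw p c m₁ m₂ g₁ g₂ μ ν = 0)
    (ω : Ω₁ × Ω₂ × Circ) : HHR g₁ g₂ ω μ = HHR g₁ g₂ ω ν := by
  have hp0 : 0 < p := zero_lt_one.trans_le hp
  have := isOpenPosMeasure_slicingLaw m₁ m₂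
  have hprob := isProbabilityMeasure_HHR hg₁_meas hg₂_meas
  rw [h2sw, ENNReal.rpow_eq_zero_iff_of_pos (by positivity), lintegral_eq_zero_iff
    (measurable_wassersteinPow_HHR hp0.le hc_lsc hg₁_meas hg₁_cont hg₂_meas hg₂_cont μ ν)] at h
  have hae : sliceLaw hg₁_meas hg₂_meas μ =ᵐ[slicingLaw m₁ m₂] sliceLaw hg₁_meas hg₂_meas ν := by
    filter_upwards [h] with ω hω
    have := hprob ω μ
    have := hprob ω ν
    exact Subtype.ext (eq_of_wassersteinPow_eq_zero (μ := HHR g₁ g₂ ω μ)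
      (ν := HHR g₁ g₂ ω ν) hp0 hc hc_lsc hω)
  -- Continuous maps that agree almost everywhere for a law of full support agree everywhere.
  have heq := Measure.eq_of_ae_eq hae
    (continuous_sliceLaw hg₁_meas hg₁_cont hg₂_meas hg₂_cont μ)
    (continuous_sliceLaw hg₁_meas hg₁_cont hg₂_meas hg₂_cont ν)
  exact congrArg ProbabilityMeasure.toMeasure (congrFun heq ω)

theorem isExtendedMetricOn_h2sw (hp : 1 ≤ p) (hc : IsMetric c)
    (hc_lsc : LowerSemicontinuous (fun z : ℝ × ℝ => c z.1 z.2))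
    (hg₁_meas : ∀ θ, Measurable (fun x => g₁ x θ)) (hg₁_cont : ∀ x, Continuous (g₁ x))
    (hg₂_meas : ∀ θ, Measurable (fun x => g₂ x θ)) (hg₂_cont : ∀ x, Continuous (g₂ x))
    {S₁ : Set (Measure (E d₁))} {S₂ : Set (Measure (E d₂))}
    (h₁ : Determines g₁ S₁) (h₂ : Determines g₂ S₂)
    (S : Set (ProbabilityMeasure (E d₁ × E d₂)))
    (hS₁ : ∀ μ ∈ S, ∀ s, ((μ : Measure (E d₁ × E d₂)).restrict s).map Prod.fst ∈ S₁)
    (hS₂ : ∀ μ ∈ S, ∀ s, ((μ : Measure (E d₁ × E d₂)).restrict s).map Prod.snd ∈ S₂) :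
    IsExtendedMetricOn S (h2sw p c m₁ m₂ g₁ g₂) where
  nonneg _ _ _ _ := zero_le
  symm μ _ ν _ := by simp only [h2sw, wassersteinPow_comm hc hc_lsc (HHR g₁ g₂ _ μ)]
  triangle μ₁ _ μ₂ _ μ₃ _ :=
    h2sw_triangle m₁ m₂ hp hc hc_lsc hg₁_meas hg₁_cont hg₂_meas hg₂_cont μ₁ μ₂ μ₃
  eq_zero_iff μ hμ ν hν := by
    have hp0 : 0 < p := zero_lt_one.trans_le hp
    refine ⟨fun h => Subtype.ext ?_, ?_⟩
    · refine eq_of_map_prod_eq (μ := (μ : Measure (E d₁ × E d₂)))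
        (ν := (ν : Measure (E d₁ × E d₂))) hg₁_meas hg₂_meas h₁ h₂ (hS₁ μ hμ) (hS₁ ν hν) (hS₂ μ hμ)
        (hS₂ ν hν) fun θ₁ θ₂ => ?_
      exact map_prodMk_eq_of_forall_circ (μ := (μ : Measure (E d₁ × E d₂)))
        (ν := (ν : Measure (E d₁ × E d₂))) ((hg₁_meas θ₁).comp measurable_fst)
        ((hg₂_meas θ₂).comp measurable_snd) fun ψ => HHR_eq_of_h2sw_eq_zero m₁ m₂ hp hc hc_lsc
          hg₁_meas hg₁_cont hg₂_meas hg₂_cont h (θ₁, θ₂, ψ)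
    · rintro rfl
      simp [h2sw, wassersteinPow_self hp0 hc _ hc_lsc, hp0]

end Metric

end H2SW

theorem theorem1 {d₁ d₂ : ℕ} {Ω₁ Ω₂ : Type*}
    [TopologicalSpace Ω₁] [TopologicalSpace.MetrizableSpace Ω₁] [SecondCountableTopology Ω₁]
    [Nonempty Ω₁] [MeasurableSpace Ω₁] [BorelSpace Ω₁]
    [TopologicalSpace Ω₂] [TopologicalSpace.MetrizableSpace Ω₂] [SecondCountableTopology Ω₂]
    [Nonempty Ω₂] [MeasurableSpace Ω₂] [BorelSpace Ω₂]
    (m₁ : Measure Ω₁) [IsFiniteMeasure m₁] [m₁.IsOpenPosMeasure]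
    (m₂ : Measure Ω₂) [IsFiniteMeasure m₂] [m₂.IsOpenPosMeasure]
    (p : ℝ) (hp : 1 ≤ p)
    (c : ℝ → ℝ → ℝ≥0) (hc : H2SW.IsMetric c)
    (hc_lsc : LowerSemicontinuous (fun z : ℝ × ℝ => c z.1 z.2))
    (g₁ : H2SW.E d₁ → Ω₁ → ℝ) (hg₁_meas : ∀ θ, Measurable (fun x => g₁ x θ))
    (hg₁_cont : ∀ x, Continuous (g₁ x))
    (g₂ : H2SW.E d₂ → Ω₂ → ℝ) (hg₂_meas : ∀ θ, Measurable (fun x => g₂ x θ))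
    (hg₂_cont : ∀ x, Continuous (g₂ x)) :
    (H2SW.GRTInjective g₁ → H2SW.GRTInjective g₂ →
      H2SW.IsExtendedMetricOn univ (H2SW.h2sw p c m₁ m₂ g₁ g₂)) ∧
    (H2SW.GRTInjectiveL1 g₁ → H2SW.GRTInjectiveL1 g₂ →
      H2SW.IsExtendedMetricOn
        {μ : ProbabilityMeasure (H2SW.E d₁ × H2SW.E d₂) |
          (μ : Measure (H2SW.E d₁ × H2SW.E d₂)) ≪ volume}
        (H2SW.h2sw p c m₁ m₂ g₁ g₂)) ∧
    (∀ μ ν : ProbabilityMeasure (H2SW.E d₁ × H2SW.E d₂),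
      H2SW.HasFiniteMoment p c m₁ m₂ g₁ g₂ μ → H2SW.HasFiniteMoment p c m₁ m₂ g₁ g₂ ν →
      H2SW.h2sw p c m₁ m₂ g₁ g₂ μ ν < ∞) := by
  refine ⟨fun h₁ h₂ => ?_, fun h₁ h₂ => ?_, fun μ ν hμ hν => ?_⟩
  · exact H2SW.isExtendedMetricOn_h2sw m₁ m₂ hp hc hc_lsc hg₁_meas hg₁_cont hg₂_meas hg₂_cont
      (h₁.determines hg₁_meas) (h₂.determines hg₂_meas) univ (fun _ _ _ => mem_univ _)
      fun _ _ _ => mem_univ _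
  · refine H2SW.isExtendedMetricOn_h2sw m₁ m₂ hp hc hc_lsc hg₁_meas hg₁_cont hg₂_meas hg₂_cont
      (h₁.determines hg₁_meas) (h₂.determines hg₂_meas) _ (fun μ hμ s => ?_) fun μ hμ s => ?_
    -- Restricting and projecting preserve absolute continuity with respect to Lebesgue measure.
    · exact ((Measure.restrict_le_self.absolutelyContinuous.trans hμ).map measurable_fst).trans
        Measure.quasiMeasurePreserving_fst.absolutelyContinuous
    · exact ((Measure.restrict_le_self.absolutelyContinuous.trans hμ).map measurable_snd).trans
        Measure.quasiMeasurePreserving_snd.absolutelyContinuous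
  · exact H2SW.h2sw_lt_top m₁ m₂ hp hc hc_lsc hg₁_meas hg₁_cont hg₂_meas hg₂_cont hμ hν
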